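/- Let $n,T\ge 1$ be integers, let $p_1,\dots,p_T\in[0,1]$, and let $G_1,\dots,G_T$ be independent Erdős–Rényi random graphs $G_t\sim\mathcal G(n,p_t)$ on the vertex set $[n]$ (every pair of distinct vertices is an edge of $G_t$ independently with probability $p_t$). For each $t$ let $C_t\in\{-1,0,1\}^{|\mathcal E_t|\times n}$ be the incidence matrix of an arbitrary orientation of the edges $\mathcal E_t$ of $G_t$ (the row of an edge oriented from $i$ to $j$ has the entry $1$ at $i$, $-1$ at $j$ and $0$ elsewhere). Let $O_T=[C_1^\top\ C_2^\top\ \cdots\ C_T^\top]^\top\in\mathbb R^{(\sum_t|\mathcal E_t|)\times n}$ be the stacked matrix and $C=\operatorname{blkdiag}(C_1,\dots,C_T)\in\mathbb R^{(\sum_t|\mathcal E_t|)\times nT}$ the block-diagonal matrix. Put $p_{\mathrm{sum}}=\sum_{t=1}^T p_t$ and $p_{\max}=\max_t p_t$. Let $\lambda_1\ge\lambda_2\ge\cdots\ge\lambda_n$ denote the ordered eigenvalues (with multiplicity) of a symmetric $n\times n$ matrix, $\lambda_{\max}=\lambda_1$, and let $\|\cdot\|_2$ denote the spectral norm. Then there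 is a universal constant $c>0$, independent of $n,T,(p_t),\delta$, such that for all such $n$, $T$, $(p_t)$, $(G_t)$ and all $\delta\in(0,1)$: 1. if $n\ge 2$ and $p_{\mathrm{sum}}\ge c\,\dfrac{\log(n/\delta)}{n}$, then $$\mathbb P\Big(\tfrac{n p_{\mathrm{sum}}}{2}\le\lambda_{n-1}(O_T^\top O_T)\le\lambda_{\max}(O_T^\top O_T)\le\tfrac{3n p_{\mathrm{sum}}}{2}\Big)\ge 1-\delta;$$ 2. (without any condition on $p_{\mathrm{sum}}$) $$\mathbb P\Big(\|C\|_2\le\min\Big\{\sqrt{2np_{\max}}+\big(2n\log(nT/\delta)\big)^{1/4},\ \sqrt{2n}\Big\}\Big)\ge 1-\delta .$$ -/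

import Mathlib

open MeasureTheory ProbabilityTheory

namespace TransSync

/-- An orientation of the edges of a simple graph: every edge `{i, j}` is given
an ordered pair of endpoints, a tail and a head. -/
structure EdgeOrientation {V : Type*} (G : SimpleGraph V) where
  tail : G.edgeSet → V
  head : G.edgeSet → V
  spec : ∀ e : G.edgeSet, s(tail e, head e) = (e : Sym2 V)

/-- Every graph has an orientation. -/
theorem EdgeOrientation.nonempty {V : Type*} (G : SimpleGraph V) :
    Nonempty (EdgeOrientation G) :=
  ⟨{ tail := fun e => (Quot.out (e : Sym2 V)).1
     head := fun e => (Quot.out (e : Sym2 V)).2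
     spec := fun e => Quot.out_eq (e : Sym2 V) }⟩

/-- The oriented incidence matrix: the row of an edge has the entry `1` at its tail,
`-1` at its head, and `0` elsewhere. -/
def incidence {V : Type*} [DecidableEq V] {G : SimpleGraph V} (o : EdgeOrientation G) :
    Matrix G.edgeSet V ℝ :=
  Matrix.of fun e v => if v = o.tail e then 1 else if v = o.head e then -1 else 0

/-- The matrix `O_T`: the incidence matrices `C_1, …, C_T` stacked on top of each other. -/
def stackedMatrix {n T : ℕ} {G : Fin T → SimpleGraph (Fin n)}
    (o : ∀ t, EdgeOrientation (G t)) : Matrix (Σ t, (G t).edgeSet) (Fin n) ℝ :=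
  Matrix.of fun e v => incidence (o e.1) e.2 v

/-- The block-diagonal matrix `C = blkdiag(C_1, …, C_T)`. -/
def blockMatrix {n T : ℕ} {G : Fin T → SimpleGraph (Fin n)}
    (o : ∀ t, EdgeOrientation (G t)) :
    Matrix (Σ t, (G t).edgeSet) (Σ _ : Fin T, Fin n) ℝ :=
  Matrix.blockDiagonal' fun t => incidence (o t)

/-- The Gram matrix `Aᵀ A` of a real matrix with finitely many rows. -/
noncomputable def gram {m k : Type*} [Finite m] (A : Matrix m k ℝ) : Matrix k k ℝ :=
  letI : Fintype m := Fintype.ofFinite m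
  A.transpose * A

theorem gram_isHermitian {m k : Type*} [Finite m] (A : Matrix m k ℝ) :
    (gram A).IsHermitian := by
  letI : Fintype m := Fintype.ofFinite m
  have h := Matrix.isHermitian_conjTranspose_mul_self A
  rwa [Matrix.conjTranspose_eq_transpose_of_trivial] at h

/-- `lambda hA k` is the `k`-th largest eigenvalue of a real symmetric `n × n` matrix, counted
with multiplicity, for `1 ≤ k ≤ n`; so `λ_1` is the largest one and `λ_n` the smallest. -/
noncomputable def lambda {n : ℕ} {A : Matrix (Fin n) (Fin n) ℝ} (hA : A.IsHermitian)
    (k : ℕ) (hk : 1 ≤ k ∧ k ≤ n) : ℝ :=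
  hA.eigenvalues₀ ⟨k - 1, by rw [Fintype.card_fin]; omega⟩

open scoped Matrix.Norms.L2Operator Classical in
/-- The spectral norm of a real matrix: its operator norm between Euclidean spaces. -/
noncomputable def specNorm {m k : Type*} [Finite m] [Finite k] (A : Matrix m k ℝ) : ℝ :=
  letI : Fintype m := Fintype.ofFinite m
  letI : Fintype k := Fintype.ofFinite k
  ‖A‖

end TransSync

namespace TransSync

/-! Both parts reduce to independent Bernoulli variables `b k`, one for each time and each pair of
distinct vertices. The Gram matrices do not depend on the orientations, because squaring a row's
value removes its sign.

Part 1. The quadratic form of `O_Tᵀ O_T` is a Bernoulli sum of the rank one forms `(x i - x j) ^ 2`.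
Its mean is `p_sum` times the Laplacian of the complete graph, that is `p_sum * (n I - J)`, which
equals `n * p_sum` on the complement of the all-ones vector. It therefore suffices that the centered
form is at most `n * p_sum / 2` times `‖x‖ ^ 2` in absolute value. This is a matrix Chernoff bound
(`bernoulliPi_exists_lt_abs_sum_le`), proved by differentiating `m θ = E tr exp (θ X)`, with no use
of Golden–Thompson or Lieb. Resampling one coordinate changes `X` by a rank one projection, and the
trace mean value inequality `trace_exp_mean_value` controls the effect. The result is the
self-bounding estimate `θ m' ≤ (θ ^ 2 r / 2) (m' + 2 μ m)`, which integrates to `m θ ≤ d exp (r μ θ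
^ 2)` for `|θ| r ≤ 1`, where `d` is the dimension. Courant–Fischer then turns form bounds into
eigenvalue bounds.

Part 2. From `(x i - x j) ^ 2 ≤ 2 (x i ^ 2 + x j ^ 2)`, the squared norm of `C` is at most twice the
largest degree over all times. Degrees are at most `n` always, and Hoeffding with a union bound over
the `n T` pairs of time and vertex gives the sharper estimate. -/

lemma sinh_le_mul_cosh {x : ℝ} (hx : 0 ≤ x) : Real.sinh x ≤ x * Real.cosh x := by
  have hmono : MonotoneOn (fun y : ℝ => y * Real.cosh y - Real.sinh y) (Set.Ici 0) := by
    refine monotoneOn_of_deriv_nonneg (convex_Ici 0) (by fun_prop) (by fun_prop) ?_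
    intro y hy
    rw [interior_Ici] at hy
    have hd : HasDerivAt (fun y : ℝ => y * Real.cosh y - Real.sinh y)
        (1 * Real.cosh y + y * Real.sinh y - Real.cosh y) y :=
      ((hasDerivAt_id y).mul (Real.hasDerivAt_cosh y)).sub (Real.hasDerivAt_sinh y)
    rw [hd.deriv]
    have := mul_nonneg (le_of_lt hy) (Real.sinh_nonneg_iff.2 (le_of_lt hy))
    linarith
  have h := hmono (Set.mem_Ici.2 le_rfl) (Set.mem_Ici.2 hx) hx
  simp at h
  linarith

/-- This is the trapezoid bound for the convex function `exp`. Once `exp ((a + b) / 2)` is factored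
out, it becomes `sinh x ≤ x cosh x` at half the difference. -/
lemma sub_mul_exp_sub_exp_le (a b : ℝ) :
    (a - b) * (Real.exp a - Real.exp b) ≤ (a - b) ^ 2 * (Real.exp a + Real.exp b) / 2 := by
  wlog h : b ≤ a generalizing a b
  · have := this b a (le_of_not_ge h)
    linarith
  have h2 := sinh_le_mul_cosh (x := (a - b) / 2) (by linarith)
  rw [Real.sinh_eq, Real.cosh_eq] at h2
  have e1 : Real.exp a = Real.exp ((a + b) / 2) * Real.exp ((a - b) / 2) := by
    rw [← Real.exp_add]; ring_nf
  have e2 : Real.exp b = Real.exp ((a + b) / 2) * Real.exp (-((a - b) / 2)) := by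
    rw [← Real.exp_add]; ring_nf
  have h3 := mul_le_mul_of_nonneg_left h2
    (mul_nonneg (sub_nonneg.2 h) (Real.exp_pos ((a + b) / 2)).le)
  rw [e1, e2]
  linarith

/-! ### Trace inequality for rank one perturbations -/

section Trace

variable {E : Type*} [NormedAddCommGroup E] [InnerProductSpace ℝ E] {ι κ : Type*}
  [Fintype ι] [Fintype κ]

/-- A mean value inequality for the trace of the exponential, for two symmetric operators, with
orthonormal eigenbases `u` and `v`, which differ by `s` times the projection `w ⊗ w`. -/
lemma trace_exp_mean_value (u : OrthonormalBasis ι ℝ E) (v : OrthonormalBasis κ ℝ E)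
    (a : ι → ℝ) (b : κ → ℝ) (w : E) (s : ℝ)
    (h : ∀ i j, s * (inner ℝ w (u i) * inner ℝ w (v j)) = (a i - b j) * inner ℝ (u i) (v j)) :
    s * (∑ i, Real.exp (a i) * inner ℝ w (u i) ^ 2 - ∑ j, Real.exp (b j) * inner ℝ w (v j) ^ 2) ≤
      s ^ 2 * ‖w‖ ^ 2 / 2 *
        (∑ i, Real.exp (a i) * inner ℝ w (u i) ^ 2 + ∑ j, Real.exp (b j) * inner ℝ w (v j) ^ 2) := by
  set P : ι → κ → ℝ := fun i j => inner ℝ (u i) (v j) ^ 2 with hP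
  -- With `A`, `B` the operators diagonal in `u`, `v`, the hypothesis reads `A - B = s • (w ⊗ w)` in
  -- mixed coordinates. The next four identities expand the diagonal entries of `A - B` and `(A - B)
  -- ^ 2` in either basis. Both sides of the claim then become double sums with the nonnegative
  -- weights `P i j`, and the scalar inequality applies termwise.
  have hu1 : ∀ i, s * inner ℝ w (u i) ^ 2 = ∑ j, (a i - b j) * P i j := by
    intro i
    have := v.sum_inner_mul_inner w (u i)
    rw [pow_two, ← mul_assoc]
    nth_rewrite 2 [← this]
    rw [Finset.mul_sum]
    refine Finset.sum_congr rfl fun j _ => ?_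
    rw [hP, real_inner_comm (u i) (v j)]
    linear_combination inner ℝ (u i) (v j) * h i j
  have hv1 : ∀ j, s * inner ℝ w (v j) ^ 2 = ∑ i, (a i - b j) * P i j := by
    intro j
    have := u.sum_inner_mul_inner w (v j)
    rw [pow_two, ← mul_assoc]
    nth_rewrite 2 [← this]
    rw [Finset.mul_sum]
    refine Finset.sum_congr rfl fun i _ => ?_
    rw [hP]
    linear_combination inner ℝ (u i) (v j) * h i j
  have hu2 : ∀ i, s ^ 2 * ‖w‖ ^ 2 * inner ℝ w (u i) ^ 2 = ∑ j, (a i - b j) ^ 2 * P i j := by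
    intro i
    have hn := v.sum_sq_inner_left w
    rw [← hn, Finset.mul_sum, Finset.sum_mul]
    refine Finset.sum_congr rfl fun j _ => ?_
    rw [hP]
    linear_combination (s * (inner ℝ w (u i) * inner ℝ w (v j)) +
      (a i - b j) * inner ℝ (u i) (v j)) * h i j
  have hv2 : ∀ j, s ^ 2 * ‖w‖ ^ 2 * inner ℝ w (v j) ^ 2 = ∑ i, (a i - b j) ^ 2 * P i j := by
    intro j
    have hn := u.sum_sq_inner_left w
    rw [← hn, Finset.mul_sum, Finset.sum_mul]
    refine Finset.sum_congr rfl fun i _ => ?_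
    rw [hP]
    linear_combination (s * (inner ℝ w (u i) * inner ℝ w (v j)) +
      (a i - b j) * inner ℝ (u i) (v j)) * h i j
  have hL : s * (∑ i, Real.exp (a i) * inner ℝ w (u i) ^ 2 -
      ∑ j, Real.exp (b j) * inner ℝ w (v j) ^ 2) =
      ∑ i, ∑ j, (a i - b j) * (Real.exp (a i) - Real.exp (b j)) * P i j := by
    have h1 : s * ∑ i, Real.exp (a i) * inner ℝ w (u i) ^ 2 =
        ∑ i, ∑ j, Real.exp (a i) * ((a i - b j) * P i j) := by
      rw [Finset.mul_sum]
      refine Finset.sum_congr rfl fun i _ => ?_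
      rw [← Finset.mul_sum, ← hu1]; ring
    have h2 : s * ∑ j, Real.exp (b j) * inner ℝ w (v j) ^ 2 =
        ∑ i, ∑ j, Real.exp (b j) * ((a i - b j) * P i j) := by
      rw [Finset.mul_sum, Finset.sum_comm]
      refine Finset.sum_congr rfl fun j _ => ?_
      rw [← Finset.mul_sum, ← hv1]; ring
    rw [mul_sub, h1, h2, ← Finset.sum_sub_distrib]
    refine Finset.sum_congr rfl fun i _ => ?_
    rw [← Finset.sum_sub_distrib]
    exact Finset.sum_congr rfl fun j _ => by ring
  have hR : s ^ 2 * ‖w‖ ^ 2 / 2 *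
        (∑ i, Real.exp (a i) * inner ℝ w (u i) ^ 2 + ∑ j, Real.exp (b j) * inner ℝ w (v j) ^ 2) =
      ∑ i, ∑ j, (a i - b j) ^ 2 * (Real.exp (a i) + Real.exp (b j)) / 2 * P i j := by
    have h1 : s ^ 2 * ‖w‖ ^ 2 * ∑ i, Real.exp (a i) * inner ℝ w (u i) ^ 2 =
        ∑ i, ∑ j, Real.exp (a i) * ((a i - b j) ^ 2 * P i j) := by
      rw [Finset.mul_sum]
      refine Finset.sum_congr rfl fun i _ => ?_
      rw [← Finset.mul_sum, ← hu2]; ring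
    have h2 : s ^ 2 * ‖w‖ ^ 2 * ∑ j, Real.exp (b j) * inner ℝ w (v j) ^ 2 =
        ∑ i, ∑ j, Real.exp (b j) * ((a i - b j) ^ 2 * P i j) := by
      rw [Finset.mul_sum, Finset.sum_comm]
      refine Finset.sum_congr rfl fun j _ => ?_
      rw [← Finset.mul_sum, ← hv2]; ring
    rw [div_mul_eq_mul_div, mul_add, h1, h2, ← Finset.sum_add_distrib, Finset.sum_div]
    refine Finset.sum_congr rfl fun i _ => ?_
    rw [← Finset.sum_add_distrib, Finset.sum_div]
    exact Finset.sum_congr rfl fun j _ => by ring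
  rw [hL, hR]
  refine Finset.sum_le_sum fun i _ => Finset.sum_le_sum fun j _ => ?_
  exact mul_le_mul_of_nonneg_right (sub_mul_exp_sub_exp_le _ _) (sq_nonneg _)

end Trace

/-! ### Finite products of Bernoulli measures -/

section Bernoulli

variable {κ : Type*} [Fintype κ]

/-- The law of independent Bernoulli variables with success probabilities `q k`. -/
noncomputable def bernoulliPi (q : κ → unitInterval) : Measure (κ → Bool) :=
  Measure.pi fun k => bernoulliMeasure true false (q k)

instance isProbabilityMeasure_bernoulliPi (q : κ → unitInterval) :
    IsProbabilityMeasure (bernoulliPi q) := by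
  unfold bernoulliPi; infer_instance

/-- The probability of an outcome under `bernoulliPi`. -/
noncomputable def bernoulliWeight (q : κ → unitInterval) (b : κ → Bool) : ℝ :=
  ∏ k, if b k then (q k : ℝ) else 1 - q k

lemma bernoulliWeight_nonneg (q : κ → unitInterval) (b : κ → Bool) : 0 ≤ bernoulliWeight q b := by
  refine Finset.prod_nonneg fun k _ => ?_
  split_ifs
  · exact (q k).2.1
  · exact sub_nonneg.2 (q k).2.2

lemma bernoulliPi_real_singleton (q : κ → unitInterval) (b : κ → Bool) :
    (bernoulliPi q).real {b} = bernoulliWeight q b := by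
  rw [bernoulliPi, measureReal_def, Measure.pi_singleton, ENNReal.toReal_prod, bernoulliWeight]
  refine Finset.prod_congr rfl fun k _ => ?_
  rw [← measureReal_def]
  cases b k <;> simp

variable [DecidableEq κ]

lemma bernoulliPi_real_eq_sum (q : κ → unitInterval) (S : Set (κ → Bool)) [DecidablePred (· ∈ S)] :
    (bernoulliPi q).real S = ∑ b, if b ∈ S then bernoulliWeight q b else 0 := by
  have h : S = ↑(Finset.univ.filter (· ∈ S)) := by simp
  conv_lhs => rw [h]
  rw [← sum_measureReal_singleton, Finset.sum_filter]
  simp_rw [bernoulliPi_real_singleton]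

lemma sum_bernoulliWeight (q : κ → unitInterval) : ∑ b, bernoulliWeight q b = 1 := by
  classical
  have := bernoulliPi_real_eq_sum q Set.univ
  simpa using this.symm

lemma bernoulliPi_real_le_of_indicator_le (q : κ → unitInterval) (S : Set (κ → Bool))
    (f : (κ → Bool) → ℝ) (h0 : ∀ b, 0 ≤ f b) (h1 : ∀ b ∈ S, 1 ≤ f b) :
    (bernoulliPi q).real S ≤ ∑ b, bernoulliWeight q b * f b := by
  classical
  rw [bernoulliPi_real_eq_sum]
  refine Finset.sum_le_sum fun b _ => ?_
  split_ifs with hb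
  · exact le_mul_of_one_le_right (bernoulliWeight_nonneg q b) (h1 b hb)
  · exact mul_nonneg (bernoulliWeight_nonneg q b) (h0 b)

/-- Conditioning on all coordinates but `k`: the expectation is unchanged when `f` is averaged over
coordinate `k`. -/
lemma sum_bernoulliWeight_mul_eq_update (q : κ → unitInterval) (k : κ) (f : (κ → Bool) → ℝ) :
    ∑ b, bernoulliWeight q b * f b = ∑ b, bernoulliWeight q b *
      (q k * f (Function.update b k true) + (1 - q k) * f (Function.update b k false)) := by
  set R : (κ → Bool) → ℝ := fun b =>
    ∏ j ∈ Finset.univ.erase k, if b j then (q j : ℝ) else 1 - q j with hR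
  have hW : ∀ b, bernoulliWeight q b = (if b k then (q k : ℝ) else 1 - q k) * R b := fun b =>
    (Finset.mul_prod_erase _ _ (Finset.mem_univ k)).symm
  have hsum : ∀ g : (κ → Bool) → ℝ, ∑ b, g b =
      ∑ c : {j // j ≠ k} → Bool, (g ((Equiv.funSplitAt k Bool).symm (true, c)) +
        g ((Equiv.funSplitAt k Bool).symm (false, c))) := by
    intro g
    rw [← (Equiv.funSplitAt k Bool).symm.sum_comp, Fintype.sum_prod_type_right]
    simp
  have hk : ∀ d c, (Equiv.funSplitAt k Bool).symm (d, c) k = d := by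
    intro d c; simp [Equiv.funSplitAt, Equiv.piSplitAt]
  have hu : ∀ d d' c, Function.update ((Equiv.funSplitAt k Bool).symm (d, c)) k d' =
      (Equiv.funSplitAt k Bool).symm (d', c) := by
    intro d d' c
    ext j
    by_cases h : j = k
    · subst h; simp [hk]
    · simp [h, Equiv.funSplitAt, Equiv.piSplitAt]
  have hRc : ∀ d d' c, R ((Equiv.funSplitAt k Bool).symm (d, c)) =
      R ((Equiv.funSplitAt k Bool).symm (d', c)) := by
    intro d d' c
    refine Finset.prod_congr rfl fun j hj => ?_
    have h := Finset.ne_of_mem_erase hj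
    simp [h, Equiv.funSplitAt, Equiv.piSplitAt]
  rw [hsum, hsum]
  refine Finset.sum_congr rfl fun c _ => ?_
  rw [hW, hW, hk, hk, hu, hu, hu, hu, hRc false true]
  simp only [if_true, Bool.false_eq_true, if_false]
  ring

/-- Comparison of `b_k - q_k` and `b_k + q_k`, weighted by a function whose increments in the
coordinate `k` are controlled by its values. -/
lemma sum_bernoulliWeight_sub_mul_le (q : κ → unitInterval) (k : κ) (F : (κ → Bool) → ℝ)
    (hF : ∀ b, 0 ≤ F b) (s C : ℝ) (hC : 0 ≤ C)
    (h : ∀ b, s * (F (Function.update b k true) - F (Function.update b k false)) ≤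
      C * (F (Function.update b k true) + F (Function.update b k false))) :
    s * ∑ b, bernoulliWeight q b * (((if b k then 1 else 0) - (q k : ℝ)) * F b) ≤
      C * ∑ b, bernoulliWeight q b * (((if b k then 1 else 0) + (q k : ℝ)) * F b) := by
  rw [sum_bernoulliWeight_mul_eq_update q k, sum_bernoulliWeight_mul_eq_update q k
    (fun b => ((if b k then 1 else 0) + (q k : ℝ)) * F b), Finset.mul_sum, Finset.mul_sum]
  refine Finset.sum_le_sum fun b _ => ?_
  simp only [Function.update_self, if_true, Bool.false_eq_true, if_false]
  have hq0 := (q k).2.1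
  have hq1 : 0 ≤ 1 - (q k : ℝ) := sub_nonneg.2 (q k).2.2
  -- After averaging, the left side is `q (1 - q) s (F₁ - F₀)`, and the right side is `C` times `q
  -- (1 - q) (F₁ + F₀) + 2 q ^ 2 F₁`. The last term is nonnegative and is dropped.
  have h1 := mul_le_mul_of_nonneg_left (h b) (mul_nonneg hq0 hq1)
  have h2 : 0 ≤ C * ((q k : ℝ) * (q k : ℝ) * F (Function.update b k true)) := by
    have := hF (Function.update b k true); positivity
  rw [mul_left_comm, mul_left_comm C]
  refine mul_le_mul_of_nonneg_left ?_ (bernoulliWeight_nonneg q b)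
  nlinarith

end Bernoulli

/-! ### Exponential trace functionals of sums of rank one operators -/

section Chernoff

variable {E : Type*} [NormedAddCommGroup E] [InnerProductSpace ℝ E]
  {κ : Type*} [Fintype κ]

/-- The symmetric operator `∑ k, c k • (a k ⊗ a k)`. -/
noncomputable def rankOneSum (a : κ → E) (c : κ → ℝ) : E →ₗ[ℝ] E :=
  ∑ k, c k • (innerₛₗ ℝ (a k)).smulRight (a k)

lemma rankOneSum_apply (a : κ → E) (c : κ → ℝ) (x : E) :
    rankOneSum a c x = ∑ k, (c k * inner ℝ (a k) x) • a k := by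
  simp [rankOneSum, smul_smul]

lemma inner_rankOneSum (a : κ → E) (c : κ → ℝ) (x y : E) :
    inner ℝ y (rankOneSum a c x) = ∑ k, c k * (inner ℝ (a k) x * inner ℝ (a k) y) := by
  rw [rankOneSum_apply, inner_sum]
  refine Finset.sum_congr rfl fun k _ => ?_
  rw [real_inner_smul_right, real_inner_comm y, mul_assoc]

lemma rankOneSum_isSymmetric (a : κ → E) (c : κ → ℝ) : (rankOneSum a c).IsSymmetric := by
  intro x y
  rw [real_inner_comm, inner_rankOneSum, inner_rankOneSum]
  exact Finset.sum_congr rfl fun k _ => by ring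

variable [FiniteDimensional ℝ E]

/-- An orthonormal eigenbasis of `∑ k, c k • (a k ⊗ a k)`. -/
noncomputable def rankOneBasis (a : κ → E) (c : κ → ℝ) :
    OrthonormalBasis (Fin (Module.finrank ℝ E)) ℝ E :=
  (rankOneSum_isSymmetric a c).eigenvectorBasis rfl

/-- The eigenvalues of `∑ k, c k • (a k ⊗ a k)`. -/
noncomputable def rankOneEigenvalue (a : κ → E) (c : κ → ℝ) : Fin (Module.finrank ℝ E) → ℝ :=
  (rankOneSum_isSymmetric a c).eigenvalues rfl

lemma rankOneSum_apply_basis (a : κ → E) (c : κ → ℝ) (i) :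
    rankOneSum a c (rankOneBasis a c i) = rankOneEigenvalue a c i • rankOneBasis a c i :=
  (rankOneSum_isSymmetric a c).apply_eigenvectorBasis rfl i

lemma rankOneEigenvalue_eq (a : κ → E) (c : κ → ℝ) (i) :
    rankOneEigenvalue a c i = ∑ k, c k * inner ℝ (a k) (rankOneBasis a c i) ^ 2 := by
  have h := inner_rankOneSum a c (rankOneBasis a c i) (rankOneBasis a c i)
  rw [rankOneSum_apply_basis, real_inner_smul_right, real_inner_self_eq_norm_sq,
    (rankOneBasis a c).orthonormal.1 i] at h
  simpa [pow_two] using h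

lemma sum_mul_inner_sq_eq (a : κ → E) (c : κ → ℝ) (x : E) :
    ∑ k, c k * inner ℝ (a k) x ^ 2 =
      ∑ i, rankOneEigenvalue a c i * inner ℝ (rankOneBasis a c i) x ^ 2 := by
  have h := inner_rankOneSum a c x x
  rw [← (rankOneBasis a c).sum_inner_mul_inner] at h
  simp only [← pow_two] at h
  rw [← h]
  refine Finset.sum_congr rfl fun i _ => ?_
  have := rankOneSum_isSymmetric a c (rankOneBasis a c i) x
  rw [← this, rankOneSum_apply_basis, real_inner_smul_left,
    real_inner_comm x]
  ring

/-- `tr (M exp (θ X))` for `X = ∑ k, c k • (a k ⊗ a k)` and `M = w ⊗ w`. -/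
noncomputable def expForm (a : κ → E) (c : κ → ℝ) (θ : ℝ) (w : E) : ℝ :=
  ∑ i, Real.exp (θ * rankOneEigenvalue a c i) * inner ℝ w (rankOneBasis a c i) ^ 2

lemma expForm_nonneg (a : κ → E) (c : κ → ℝ) (θ : ℝ) (w : E) : 0 ≤ expForm a c θ w :=
  Finset.sum_nonneg fun _ _ => by positivity

/-- `tr (exp (θ X))` for `X = ∑ k, c k • (a k ⊗ a k)`. -/
noncomputable def expTrace (a : κ → E) (c : κ → ℝ) (θ : ℝ) : ℝ :=
  ∑ i, Real.exp (θ * rankOneEigenvalue a c i)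

lemma expTrace_nonneg (a : κ → E) (c : κ → ℝ) (θ : ℝ) : 0 ≤ expTrace a c θ :=
  Finset.sum_nonneg fun _ _ => by positivity

/-- The derivative of `expTrace` in `θ`. -/
noncomputable def expTraceDeriv (a : κ → E) (c : κ → ℝ) (θ : ℝ) : ℝ :=
  ∑ i, rankOneEigenvalue a c i * Real.exp (θ * rankOneEigenvalue a c i)

lemma hasDerivAt_expTrace (a : κ → E) (c : κ → ℝ) (θ : ℝ) :
    HasDerivAt (expTrace a c) (expTraceDeriv a c θ) θ := by
  unfold expTrace expTraceDeriv
  refine HasDerivAt.fun_sum fun i _ => ?_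
  have := ((hasDerivAt_id θ).mul_const (rankOneEigenvalue a c i)).exp
  simpa [mul_comm] using this

/-- Each eigenvalue is the Rayleigh quotient of its eigenvector, so `tr (X exp (θ X))` splits over
the rank one summands of `X`. -/
lemma expTraceDeriv_eq (a : κ → E) (c : κ → ℝ) (θ : ℝ) :
    expTraceDeriv a c θ = ∑ k, c k * expForm a c θ (a k) := by
  unfold expTraceDeriv expForm
  simp_rw [Finset.mul_sum]
  rw [Finset.sum_comm]
  refine Finset.sum_congr rfl fun i _ => ?_
  have h := congrArg (· * Real.exp (θ * rankOneEigenvalue a c i)) (rankOneEigenvalue_eq a c i)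
  simp only [Finset.sum_mul] at h
  rw [h]
  exact Finset.sum_congr rfl fun k _ => by ring

/-- If `M ≤ μ I`, then `tr (M exp (θ X)) ≤ μ tr (exp (θ X))`: test `M` on the eigenvectors of `X`
and weight by the positive exponentials. -/
lemma sum_mul_expForm_le (a : κ → E) (c d : κ → ℝ) (θ μ : ℝ)
    (h : ∀ x, ∑ k, d k * inner ℝ (a k) x ^ 2 ≤ μ * ‖x‖ ^ 2) :
    ∑ k, d k * expForm a c θ (a k) ≤ μ * expTrace a c θ := by
  unfold expTrace expForm
  simp_rw [Finset.mul_sum]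
  rw [Finset.sum_comm]
  refine Finset.sum_le_sum fun i _ => ?_
  have h1 := h (rankOneBasis a c i)
  rw [(rankOneBasis a c).orthonormal.1 i] at h1
  have h2 := mul_le_mul_of_nonneg_left h1 (Real.exp_pos (θ * rankOneEigenvalue a c i)).le
  rw [Finset.mul_sum] at h2
  calc _ = ∑ k, Real.exp (θ * rankOneEigenvalue a c i) *
        (d k * inner ℝ (a k) (rankOneBasis a c i) ^ 2) :=
        Finset.sum_congr rfl fun k _ => by ring
    _ ≤ _ := h2
    _ = _ := by ring

/-- Flipping coordinate `k` adds exactly `a k ⊗ a k`, so the trace mean value inequality applies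
with `w = a k` and `s = θ`. -/
lemma expForm_sub_le [DecidableEq κ] (a : κ → E) (c c' : κ → ℝ) (θ : ℝ) (k : κ)
    (h : ∀ j, c j = c' j + if j = k then 1 else 0) :
    θ * (expForm a c θ (a k) - expForm a c' θ (a k)) ≤
      θ ^ 2 * ‖a k‖ ^ 2 / 2 * (expForm a c θ (a k) + expForm a c' θ (a k)) := by
  refine trace_exp_mean_value (rankOneBasis a c) (rankOneBasis a c') _ _ (a k) θ fun i j => ?_
  set u := rankOneBasis a c i with hu
  set v := rankOneBasis a c' j with hv
  have h1 : inner ℝ v (rankOneSum a c u) = rankOneEigenvalue a c i * inner ℝ u v := by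
    rw [rankOneSum_apply_basis, real_inner_smul_right, real_inner_comm]
  have h2 : inner ℝ v (rankOneSum a c' u) = rankOneEigenvalue a c' j * inner ℝ u v := by
    rw [← rankOneSum_isSymmetric, rankOneSum_apply_basis, real_inner_smul_left, real_inner_comm]
  have h3 : inner ℝ v (rankOneSum a c u) =
      inner ℝ v (rankOneSum a c' u) + inner ℝ (a k) u * inner ℝ (a k) v := by
    rw [inner_rankOneSum, inner_rankOneSum]
    simp only [h, add_mul, Finset.sum_add_distrib]
    simp
  rw [h1, h2] at h3
  linear_combination (-θ) * h3

end Chernoff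

/-- Moving along `s * θ` for `s` in `[0, 1]` treats both signs of `θ` at once. -/
lemma le_apply_zero_of_mul_deriv_nonpos {h h' : ℝ → ℝ} (θ : ℝ)
    (hd : ∀ y, HasDerivAt h (h' y) y) (hs : ∀ y, |y| ≤ |θ| → y * h' y ≤ 0) : h θ ≤ h 0 := by
  have hd' : ∀ s : ℝ, HasDerivAt (fun s => h (s * θ)) (h' (s * θ) * (1 * θ)) s := fun s =>
    (hd (s * θ)).comp s ((hasDerivAt_id s).mul_const θ)
  have hanti : AntitoneOn (fun s : ℝ => h (s * θ)) (Set.Icc 0 1) := by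
    refine antitoneOn_of_deriv_nonpos (convex_Icc 0 1)
      (fun s _ => (hd' s).continuousAt.continuousWithinAt)
      (fun s _ => (hd' s).differentiableAt.differentiableWithinAt) fun s hs' => ?_
    rw [interior_Icc] at hs'
    rw [(hd' s).deriv]
    have h1 := hs (s * θ) (by
      rw [abs_mul, abs_of_pos hs'.1]
      exact mul_le_of_le_one_left (abs_nonneg _) hs'.2.le)
    have h2 : s * (h' (s * θ) * (1 * θ)) ≤ 0 := by linarith
    by_contra hcon
    have := mul_pos hs'.1 (not_le.1 hcon)
    linarith
  simpa using hanti (Set.left_mem_Icc.2 zero_le_one) (Set.right_mem_Icc.2 zero_le_one) zero_le_one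

/-! ### The trace moment generating function and matrix Chernoff -/

section Chernoff

variable {E : Type*} [NormedAddCommGroup E] [InnerProductSpace ℝ E] [FiniteDimensional ℝ E]
  {κ : Type*} [Fintype κ] [DecidableEq κ]

/-- The centered Bernoulli variables `b k - q k`. -/
noncomputable def centered (q : κ → unitInterval) (b : κ → Bool) (k : κ) : ℝ :=
  (if b k then 1 else 0) - (q k : ℝ)

/-- The trace moment generating function of `∑ k, (b k - q k) • (a k ⊗ a k)`. -/
noncomputable def traceMGF (a : κ → E) (q : κ → unitInterval) (θ : ℝ) : ℝ :=
  ∑ b, bernoulliWeight q b * expTrace a (centered q b) θ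

/-- The derivative of `traceMGF`. -/
noncomputable def traceMGFDeriv (a : κ → E) (q : κ → unitInterval) (θ : ℝ) : ℝ :=
  ∑ b, bernoulliWeight q b * expTraceDeriv a (centered q b) θ

lemma hasDerivAt_traceMGF (a : κ → E) (q : κ → unitInterval) (θ : ℝ) :
    HasDerivAt (traceMGF a q) (traceMGFDeriv a q θ) θ := by
  unfold traceMGF traceMGFDeriv
  exact HasDerivAt.fun_sum fun b _ => (hasDerivAt_expTrace a _ θ).const_mul _

lemma traceMGF_nonneg (a : κ → E) (q : κ → unitInterval) (θ : ℝ) : 0 ≤ traceMGF a q θ :=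
  Finset.sum_nonneg fun b _ => mul_nonneg (bernoulliWeight_nonneg q b) (expTrace_nonneg a _ θ)

lemma traceMGF_zero (a : κ → E) (q : κ → unitInterval) :
    traceMGF a q 0 = Module.finrank ℝ E := by
  simp [traceMGF, expTrace, ← Finset.sum_mul, sum_bernoulliWeight]

/-- The self-bounding estimate. The coordinatewise comparison replaces `b k - q k` by `b k + q k =
(b k - q k) + 2 q k`. The first part reproduces the derivative, and the second is controlled by the
bound `μ` on the mean form. -/
lemma mul_traceMGFDeriv_le (a : κ → E) (q : κ → unitInterval) (r μ : ℝ) (hr : 0 ≤ r)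
    (ha : ∀ k, ‖a k‖ ^ 2 ≤ r) (hμ : ∀ x, ∑ k, (q k : ℝ) * inner ℝ (a k) x ^ 2 ≤ μ * ‖x‖ ^ 2)
    (θ : ℝ) :
    θ * traceMGFDeriv a q θ ≤
      θ ^ 2 * r / 2 * (traceMGFDeriv a q θ + 2 * (μ * traceMGF a q θ)) := by
  have hk : ∀ k, θ * ∑ b, bernoulliWeight q b *
        (((if b k then 1 else 0) - (q k : ℝ)) * expForm a (centered q b) θ (a k)) ≤
      θ ^ 2 * r / 2 * ∑ b, bernoulliWeight q b *
        (((if b k then 1 else 0) + (q k : ℝ)) * expForm a (centered q b) θ (a k)) := by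
    intro k
    refine sum_bernoulliWeight_sub_mul_le q k (fun b => expForm a (centered q b) θ (a k))
      (fun b => expForm_nonneg _ _ _ _) θ _ (by positivity) fun b => ?_
    refine (expForm_sub_le a _ _ θ k fun j => ?_).trans ?_
    · by_cases hj : j = k
      · subst hj; simp [centered, sub_eq_neg_add]
      · simp [centered, hj]
    · have := ha k
      refine mul_le_mul_of_nonneg_right ?_
        (add_nonneg (expForm_nonneg _ _ _ _) (expForm_nonneg _ _ _ _))
      gcongr
  have hD : traceMGFDeriv a q θ = ∑ k, ∑ b, bernoulliWeight q b *
        (((if b k then 1 else 0) - (q k : ℝ)) * expForm a (centered q b) θ (a k)) := by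
    rw [Finset.sum_comm]
    refine Finset.sum_congr rfl fun b _ => ?_
    rw [expTraceDeriv_eq, Finset.mul_sum]
    rfl
  have hS : ∑ k, ∑ b, bernoulliWeight q b *
        (((if b k then 1 else 0) + (q k : ℝ)) * expForm a (centered q b) θ (a k)) ≤
      traceMGFDeriv a q θ + 2 * (μ * traceMGF a q θ) := by
    rw [Finset.sum_comm, traceMGFDeriv, traceMGF, Finset.mul_sum, Finset.mul_sum,
      ← Finset.sum_add_distrib]
    refine Finset.sum_le_sum fun b _ => ?_
    have h1 := sum_mul_expForm_le a (centered q b) (fun k => (q k : ℝ)) θ μ hμ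
    have h2 := mul_le_mul_of_nonneg_left h1 (bernoulliWeight_nonneg q b)
    rw [expTraceDeriv_eq, ← Finset.mul_sum]
    have h3 : ∑ k, ((if b k then 1 else 0) + (q k : ℝ)) * expForm a (centered q b) θ (a k) =
        ∑ k, centered q b k * expForm a (centered q b) θ (a k) +
          2 * ∑ k, (q k : ℝ) * expForm a (centered q b) θ (a k) := by
      rw [Finset.mul_sum, ← Finset.sum_add_distrib]
      refine Finset.sum_congr rfl fun k _ => ?_
      rw [centered]; ring
    rw [h3, mul_add]
    linarith
  calc θ * traceMGFDeriv a q θ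
      ≤ θ ^ 2 * r / 2 * ∑ k, ∑ b, bernoulliWeight q b *
        (((if b k then 1 else 0) + (q k : ℝ)) * expForm a (centered q b) θ (a k)) := by
        rw [hD, Finset.mul_sum, Finset.mul_sum]
        exact Finset.sum_le_sum fun k _ => hk k
    _ ≤ _ := mul_le_mul_of_nonneg_left hS (by positivity)

lemma traceMGF_le (a : κ → E) (q : κ → unitInterval) (r μ : ℝ) (hr : 0 ≤ r) (hμ0 : 0 ≤ μ)
    (ha : ∀ k, ‖a k‖ ^ 2 ≤ r) (hμ : ∀ x, ∑ k, (q k : ℝ) * inner ℝ (a k) x ^ 2 ≤ μ * ‖x‖ ^ 2)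
    (θ : ℝ) (hθ : |θ| * r ≤ 1) :
    traceMGF a q θ ≤ Module.finrank ℝ E * Real.exp (r * μ * θ ^ 2) := by
  have hd : ∀ y, HasDerivAt (fun y => traceMGF a q y * Real.exp (-(r * μ * y ^ 2)))
      (traceMGFDeriv a q y * Real.exp (-(r * μ * y ^ 2)) +
        traceMGF a q y * (Real.exp (-(r * μ * y ^ 2)) * (-(r * μ * (2 * y))))) y := by
    intro y
    refine (hasDerivAt_traceMGF a q y).mul (HasDerivAt.exp ?_)
    simpa using (((hasDerivAt_id y).fun_pow 2).const_mul (r * μ)).fun_neg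
  have h := le_apply_zero_of_mul_deriv_nonpos θ hd fun y hy => by
    have h1 := mul_traceMGFDeriv_le a q r μ hr ha hμ y
    have hm := traceMGF_nonneg a q y
    have hyr : |y| * r ≤ 1 := (mul_le_mul_of_nonneg_right hy hr).trans hθ
    have hyr' : y * r ≤ 1 := (mul_le_mul_of_nonneg_right (le_abs_self y) hr).trans hyr
    -- Since `y r ≤ 1`, the derivative term on the right of `h1` absorbs at most half of a positive
    -- left side.
    have h2 : y * traceMGFDeriv a q y ≤ 2 * (y ^ 2 * r * μ * traceMGF a q y) := by
      have h0 : 0 ≤ y ^ 2 * r * μ * traceMGF a q y := by positivity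
      by_contra hcon
      have h3 := not_le.1 hcon
      nlinarith
    have h4 := mul_nonneg (Real.exp_pos (-(r * μ * y ^ 2))).le (sub_nonneg.2 h2)
    nlinarith
  simp only [ne_eq, OfNat.ofNat_ne_zero, not_false_eq_true, zero_pow, mul_zero, neg_zero,
    Real.exp_zero, mul_one, traceMGF_zero] at h
  rw [Real.exp_neg] at h
  have hpos := Real.exp_pos (r * μ * θ ^ 2)
  rwa [← div_eq_mul_inv, div_le_iff₀ hpos] at h

/-- **Matrix Chernoff inequality** for sums of independent rank one Bernoulli matrices. -/
theorem bernoulliPi_exists_lt_abs_sum_le (a : κ → E) (q : κ → unitInterval) (r μ : ℝ)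
    (hr : 0 ≤ r) (hμ0 : 0 ≤ μ) (ha : ∀ k, ‖a k‖ ^ 2 ≤ r)
    (hμ : ∀ x, ∑ k, (q k : ℝ) * inner ℝ (a k) x ^ 2 ≤ μ * ‖x‖ ^ 2)
    (θ t : ℝ) (hθ0 : 0 ≤ θ) (hθ : θ * r ≤ 1) :
    (bernoulliPi q).real
        {b | ∃ x : E, t * ‖x‖ ^ 2 < |∑ k, centered q b k * inner ℝ (a k) x ^ 2|} ≤
      2 * (Module.finrank ℝ E * Real.exp (r * μ * θ ^ 2 - θ * t)) := by
  have hb := bernoulliPi_real_le_of_indicator_le q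
    {b | ∃ x : E, t * ‖x‖ ^ 2 < |∑ k, centered q b k * inner ℝ (a k) x ^ 2|}
    (fun b => Real.exp (-(θ * t)) *
      (expTrace a (centered q b) θ + expTrace a (centered q b) (-θ)))
    (fun b => mul_nonneg (Real.exp_pos _).le
      (add_nonneg (expTrace_nonneg _ _ _) (expTrace_nonneg _ _ _))) (by
      rintro b ⟨x, hx⟩
      -- A large value of the form forces an eigenvalue of modulus at least `t`. According to its
      -- sign, one of the traces at `θ` and `-θ` is then at least `exp (θ t)`.
      have key : ∃ i, t ≤ |rankOneEigenvalue a (centered q b) i| := by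
        by_contra! hcon
        rw [sum_mul_inner_sq_eq] at hx
        refine absurd hx (not_lt.2 ?_)
        rw [← (rankOneBasis a (centered q b)).sum_sq_inner_right x, Finset.mul_sum]
        refine (Finset.abs_sum_le_sum_abs _ _).trans (Finset.sum_le_sum fun i _ => ?_)
        rw [abs_mul, abs_of_nonneg (sq_nonneg (inner ℝ (rankOneBasis a (centered q b) i) x))]
        exact mul_le_mul_of_nonneg_right (hcon i).le (sq_nonneg _)
      obtain ⟨i, hi⟩ := key
      rw [Real.exp_neg, ← div_eq_inv_mul, le_div_iff₀ (Real.exp_pos _), one_mul]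
      have hs : ∀ s, Real.exp (s * rankOneEigenvalue a (centered q b) i) ≤
          expTrace a (centered q b) s := fun s =>
        Finset.single_le_sum (f := fun i => Real.exp (s * rankOneEigenvalue a (centered q b) i))
          (fun _ _ => (Real.exp_pos _).le) (Finset.mem_univ i)
      rcases le_abs.1 hi with h | h
      · have := Real.exp_le_exp.2 (mul_le_mul_of_nonneg_left h hθ0)
        have := expTrace_nonneg a (centered q b) (-θ)
        linarith [hs θ]
      · have := Real.exp_le_exp.2 (mul_le_mul_of_nonneg_left h hθ0)
        rw [mul_neg, ← neg_mul] at this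
        have := expTrace_nonneg a (centered q b) θ
        linarith [hs (-θ)])
  refine hb.trans ?_
  have h1 := traceMGF_le a q r μ hr hμ0 ha hμ θ (by rwa [abs_of_nonneg hθ0])
  have h2 := traceMGF_le a q r μ hr hμ0 ha hμ (-θ) (by rwa [abs_neg, abs_of_nonneg hθ0])
  rw [neg_sq] at h2
  have h3 : ∑ b, bernoulliWeight q b * (Real.exp (-(θ * t)) *
      (expTrace a (centered q b) θ + expTrace a (centered q b) (-θ))) =
      Real.exp (-(θ * t)) * (traceMGF a q θ + traceMGF a q (-θ)) := by
    rw [traceMGF, traceMGF, ← Finset.sum_add_distrib, Finset.mul_sum]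
    exact Finset.sum_congr rfl fun b _ => by ring
  rw [h3, sub_eq_add_neg, Real.exp_add]
  have h4 := mul_le_mul_of_nonneg_left (add_le_add h1 h2) (Real.exp_pos (-(θ * t))).le
  linarith

end Chernoff

/-! ### Random graphs as images of Bernoulli variables -/

/-- The pairs of distinct vertices, one copy for each of the `T` graphs. -/
abbrev TimedPair (n T : ℕ) : Type := Fin T × {e : Sym2 (Fin n) // ¬ e.IsDiag}

variable {n T : ℕ}

/-- The sequence of graphs whose edges are selected by `b`. -/
def graphsOf (b : TimedPair n T → Bool) (t : Fin T) : SimpleGraph (Fin n) :=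
  SimpleGraph.fromEdgeSet {e | ∃ h : ¬ e.IsDiag, b (t, ⟨e, h⟩) = true}

lemma mem_edgeSet_graphsOf (b : TimedPair n T → Bool) (k : TimedPair n T) :
    (k.2 : Sym2 (Fin n)) ∈ (graphsOf b k.1).edgeSet ↔ b k = true := by
  obtain ⟨t, e, he⟩ := k
  simp [graphsOf, he]

lemma graphsOf_eq_iff (b : TimedPair n T → Bool) (g : Fin T → SimpleGraph (Fin n)) :
    graphsOf b = g ↔ ∀ k, b k = true ↔ (k.2 : Sym2 (Fin n)) ∈ (g k.1).edgeSet := by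
  constructor
  · rintro rfl k
    exact (mem_edgeSet_graphsOf b k).symm
  · intro h
    funext t
    refine SimpleGraph.edgeSet_injective (Set.ext fun e => ?_)
    by_cases he : e.IsDiag
    · exact iff_of_false (fun h' => SimpleGraph.not_isDiag_of_mem_edgeSet _ h' he)
        (fun h' => SimpleGraph.not_isDiag_of_mem_edgeSet _ h' he)
    · exact (mem_edgeSet_graphsOf b (t, ⟨e, he⟩)).trans (h (t, ⟨e, he⟩))

instance measurableSingletonClass_simpleGraph :
    MeasurableSingletonClass (SimpleGraph (Fin n)) where
  measurableSet_singleton g := by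
    have h : ({g} : Set (SimpleGraph (Fin n))) = SimpleGraph.edgeSet ⁻¹' {g.edgeSet} := by
      ext g'; simp
    rw [h]
    exact SimpleGraph.measurable_edgeSet (MeasurableSet.singleton _)

lemma prod_bernoulliMeasure_singleton (p : unitInterval) (g : SimpleGraph (Fin n))
    (b : {e : Sym2 (Fin n) // ¬ e.IsDiag} → Bool)
    (hb : ∀ e, b e = true ↔ (e : Sym2 (Fin n)) ∈ g.edgeSet) :
    ∏ e, bernoulliMeasure true false p {b e} = SimpleGraph.binomialRandom (Fin n) p {g} := by
  classical
  rw [SimpleGraph.binomialRandom_singleton]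
  have h1 : ∀ e, bernoulliMeasure true false p {b e} =
      if b e = true then (unitInterval.toNNReal p : ENNReal)
      else (unitInterval.toNNReal (unitInterval.symm p) : ENNReal) := by
    intro e
    cases b e <;> simp
  simp_rw [h1]
  rw [Finset.prod_ite, Finset.prod_const, Finset.prod_const]
  have hc : (Finset.univ.filter fun e => b e = true).card = g.edgeSet.ncard := by
    rw [← Set.ncard_coe_finset]
    refine Set.ncard_congr (fun e _ => (e : Sym2 (Fin n))) ?_ ?_ ?_
    · intro e he
      simpa [hb] using he
    · intro e e' _ _ h
      exact Subtype.ext h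
    · intro e he
      exact ⟨⟨e, SimpleGraph.not_isDiag_of_mem_edgeSet _ he⟩, by simpa [hb] using he, rfl⟩
  have ht : Fintype.card {e : Sym2 (Fin n) // ¬ e.IsDiag} = (Nat.card (Fin n)).choose 2 := by
    rw [Nat.card_eq_fintype_card, ← Sym2.card_subtype_not_diag]
  have hc' : (Finset.univ.filter fun e => ¬ b e = true).card =
      (Nat.card (Fin n)).choose 2 - g.edgeSet.ncard := by
    rw [← ht, ← hc, Finset.filter_not, Finset.card_sdiff_of_subset (Finset.filter_subset _ _),
      Finset.card_univ]
  rw [hc, hc']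

lemma map_graphsOf_bernoulliPi (p : Fin T → unitInterval) :
    (bernoulliPi fun k : TimedPair n T => p k.1).map graphsOf =
      Measure.pi fun t => SimpleGraph.binomialRandom (Fin n) (p t) := by
  classical
  refine Measure.ext_of_singleton fun g => ?_
  rw [Measure.map_apply (measurable_of_finite _) (MeasurableSet.singleton _), Measure.pi_singleton]
  have h : graphsOf ⁻¹' {g} =
      {fun k : TimedPair n T => decide ((k.2 : Sym2 (Fin n)) ∈ (g k.1).edgeSet)} := by
    ext b
    rw [Set.mem_preimage, Set.mem_singleton_iff, graphsOf_eq_iff, Set.mem_singleton_iff, funext_iff]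
    refine forall_congr' fun k => ?_
    by_cases hk : (k.2 : Sym2 (Fin n)) ∈ (g k.1).edgeSet <;> simp [hk]
  rw [h, bernoulliPi, Measure.pi_singleton, Fintype.prod_prod_type]
  refine Finset.prod_congr rfl fun t _ => ?_
  exact prod_bernoulliMeasure_singleton (p t) (g t) _ fun e => by simp

/-- Probabilities of events of independent random graphs, in terms of the underlying
Bernoulli variables. -/
lemma one_sub_le_measureReal_of_graphsOf {Ω : Type*} [MeasurableSpace Ω] {μ : Measure Ω}
    [IsProbabilityMeasure μ] {p : Fin T → unitInterval} {G : Fin T → Ω → SimpleGraph (Fin n)}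
    (hG : ∀ t, HasLaw (G t) (SimpleGraph.binomialRandom (Fin n) (p t)) μ) (hi : iIndepFun G μ)
    (S : Set Ω) (bad : Set (TimedPair n T → Bool)) {δ : ℝ}
    (hbad : (bernoulliPi fun k : TimedPair n T => p k.1).real bad ≤ δ)
    (hS : ∀ ω b, (fun t => G t ω) = graphsOf b → b ∉ bad → ω ∈ S) :
    1 - δ ≤ μ.real S := by
  have hm : ∀ t, AEMeasurable (G t) μ := fun t => (hG t).aemeasurable
  have hmap : μ.map (fun ω t => G t ω) =
      (bernoulliPi fun k : TimedPair n T => p k.1).map graphsOf := by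
    rw [(iIndepFun_iff_map_fun_eq_pi_map hm).1 hi, map_graphsOf_bernoulliPi]
    simp_rw [(hG _).map_eq]
  -- `S` need not be measurable, as orientations may vary arbitrarily with `ω`. The preimage of this
  -- finite set of graph sequences lies inside `S`, and monotonicity of the measure suffices.
  have hA : MeasurableSet (graphsOf '' badᶜ) := (Set.toFinite _).measurableSet
  have hsub : (fun ω t => G t ω) ⁻¹' (graphsOf '' badᶜ) ⊆ S := by
    rintro ω ⟨b, hb, hbω⟩
    exact hS ω b hbω.symm hb
  have h1 : μ.real ((fun ω t => G t ω) ⁻¹' (graphsOf '' badᶜ)) =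
      (bernoulliPi fun k : TimedPair n T => p k.1).real (graphsOf ⁻¹' (graphsOf '' badᶜ)) := by
    rw [← map_measureReal_apply_of_aemeasurable (aemeasurable_pi_lambda _ hm) hA, hmap,
      map_measureReal_apply (measurable_of_finite _) hA]
  calc 1 - δ ≤ 1 - (bernoulliPi fun k : TimedPair n T => p k.1).real bad := by linarith
    _ = (bernoulliPi fun k : TimedPair n T => p k.1).real badᶜ :=
        (probReal_compl_eq_one_sub (Set.toFinite _).measurableSet).symm
    _ ≤ _ := measureReal_mono (Set.subset_preimage_image _ _)
    _ = _ := h1.symm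
    _ ≤ _ := measureReal_mono hsub

lemma sum_sigma_edgeSet (g : Fin T → SimpleGraph (Fin n)) (inst : Fintype (Σ t, (g t).edgeSet))
    (b : TimedPair n T → Bool) (hg : g = graphsOf b) (f : Fin T → Sym2 (Fin n) → ℝ) :
    ∑ s : Σ t, (g t).edgeSet, f s.1 s.2 = ∑ k, if b k then f k.1 k.2 else 0 := by
  rw [← Finset.sum_filter]
  refine Finset.sum_bij (fun s _ => (s.1, ⟨s.2, SimpleGraph.not_isDiag_of_mem_edgeSet _ s.2.2⟩))
    ?_ ?_ ?_ ?_
  · rintro ⟨t, e, he⟩ _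
    rw [Finset.mem_filter]
    refine ⟨Finset.mem_univ _, ?_⟩
    subst hg
    exact (mem_edgeSet_graphsOf b _).1 he
  · rintro ⟨t, e, he⟩ _ ⟨t', e', he'⟩ _ h
    simp only [Prod.mk.injEq, Subtype.mk.injEq] at h
    obtain ⟨rfl, rfl⟩ := h
    rfl
  · rintro ⟨t, e, he⟩ hk
    subst hg
    exact ⟨⟨t, e, (mem_edgeSet_graphsOf b (t, ⟨e, he⟩)).2 (Finset.mem_filter.1 hk).2⟩,
      Finset.mem_univ _, rfl⟩
  · rintro ⟨t, e, he⟩ _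
    rfl

/-! ### Edge forms and the Laplacian of the complete graph -/

/-- `(x i - x j) ^ 2` for an unordered pair `{i, j}`. -/
def sqDiff (x : Fin n → ℝ) : Sym2 (Fin n) → ℝ :=
  Sym2.lift ⟨fun i j => (x i - x j) ^ 2, fun _ _ => by ring⟩

@[simp] lemma sqDiff_mk (x : Fin n → ℝ) (i j : Fin n) : sqDiff x s(i, j) = (x i - x j) ^ 2 := rfl

/-- The vector `e_i - e_j` of an unordered pair `{i, j}`, with some choice of the sign. -/
noncomputable def pairVector (e : Sym2 (Fin n)) : EuclideanSpace ℝ (Fin n) :=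
  EuclideanSpace.single (Quot.out e).1 1 - EuclideanSpace.single (Quot.out e).2 1

lemma inner_pairVector_sq (e : Sym2 (Fin n)) (x : EuclideanSpace ℝ (Fin n)) :
    inner ℝ (pairVector e) x ^ 2 = sqDiff x e := by
  have he : s((Quot.out e).1, (Quot.out e).2) = e := Quot.out_eq e
  conv_rhs => rw [← he]
  rw [pairVector, inner_sub_left, EuclideanSpace.inner_single_left,
    EuclideanSpace.inner_single_left, sqDiff_mk]
  simp

lemma norm_pairVector_sq_le (e : Sym2 (Fin n)) : ‖pairVector e‖ ^ 2 ≤ 2 := by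
  rw [pairVector, norm_sub_sq_real, EuclideanSpace.inner_single_left]
  simp only [PiLp.norm_single, norm_one, map_one, one_mul, PiLp.single_apply]
  split_ifs <;> norm_num

/-- The complete graph has Laplacian `n I - J`. The proof symmetrizes the sum over `i < j` to all
ordered pairs. -/
lemma sum_sqDiff (x : Fin n → ℝ) :
    ∑ e : {e : Sym2 (Fin n) // ¬ e.IsDiag}, sqDiff x e = n * ∑ i, x i ^ 2 - (∑ i, x i) ^ 2 := by
  have h1 : ∑ e : {e : Sym2 (Fin n) // ¬ e.IsDiag}, sqDiff x e =
      ∑ i : Fin n × Fin n, if i.1 < i.2 then (x i.1 - x i.2) ^ 2 else 0 := by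
    rw [← Finset.sum_subtype (Finset.univ.filter fun e : Sym2 (Fin n) => ¬ e.IsDiag) (by simp)
      (sqDiff x), ← Finset.sym2_univ, Finset.sum_sym2_filter_not_isDiag, ← Finset.sum_filter]
    refine Finset.sum_congr ?_ fun _ _ => rfl
    ext ⟨i, j⟩
    simp only [Finset.mem_filter, Finset.mem_offDiag, Finset.mem_univ, true_and, ne_eq,
      and_iff_right_iff_imp]
    exact fun h => h.ne
  have h2 : ∑ i : Fin n × Fin n, (if i.1 < i.2 then (x i.1 - x i.2) ^ 2 else 0) =
      ∑ i : Fin n × Fin n, if i.2 < i.1 then (x i.1 - x i.2) ^ 2 else 0 := by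
    rw [← (Equiv.prodComm (Fin n) (Fin n)).sum_comp]
    refine Finset.sum_congr rfl fun i _ => ?_
    simp only [Equiv.prodComm_apply, Prod.fst_swap, Prod.snd_swap]
    exact if_congr Iff.rfl (by ring) rfl
  have h3 : ∑ i : Fin n × Fin n, (if i.1 < i.2 then (x i.1 - x i.2) ^ 2 else 0) +
      ∑ i : Fin n × Fin n, (if i.2 < i.1 then (x i.1 - x i.2) ^ 2 else 0) =
      ∑ i : Fin n × Fin n, (x i.1 - x i.2) ^ 2 := by
    rw [← Finset.sum_add_distrib]
    refine Finset.sum_congr rfl fun i _ => ?_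
    rcases lt_trichotomy i.1 i.2 with h | h | h
    · simp [h, h.not_gt]
    · simp [h]
    · simp [h, h.not_gt]
  have h4 : ∑ i : Fin n × Fin n, (x i.1 - x i.2) ^ 2 =
      2 * (n * ∑ i, x i ^ 2 - (∑ i, x i) ^ 2) := by
    rw [Fintype.sum_prod_type]
    simp only [sub_sq, Finset.sum_add_distrib, Finset.sum_sub_distrib, Finset.sum_const,
      Finset.card_univ, Fintype.card_fin, nsmul_eq_mul, ← Finset.mul_sum, ← Finset.sum_mul]
    ring
  rw [h1]
  linarith

/-! ### Eigenvalue bounds from quadratic forms -/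

section Eigenvalues

variable {E : Type*} [NormedAddCommGroup E] [InnerProductSpace ℝ E] [FiniteDimensional ℝ E]
  {S : E →ₗ[ℝ] E} {N : ℕ}

lemma eigenvalues_le_of_inner_le (hS : S.IsSymmetric) (hN : Module.finrank ℝ E = N) {C : ℝ}
    (h : ∀ x, inner ℝ x (S x) ≤ C * ‖x‖ ^ 2) (i : Fin N) : hS.eigenvalues hN i ≤ C := by
  have h1 := h (hS.eigenvectorBasis hN i)
  rw [hS.apply_eigenvectorBasis, real_inner_smul_right, real_inner_self_eq_norm_sq,
    (hS.eigenvectorBasis hN).orthonormal.1 i] at h1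
  simpa using h1

/-- Courant–Fischer in codimension one: the plane spanned by the eigenvectors `i` and `j` meets the
hyperplane `w⊥` nontrivially, and on that plane the form is at most the larger eigenvalue, the one
at `i`. -/
lemma le_eigenvalues_of_le_inner (hS : S.IsSymmetric) (hN : Module.finrank ℝ E = N) {C : ℝ} (w : E)
    (h : ∀ x, inner ℝ w x = 0 → C * ‖x‖ ^ 2 ≤ inner ℝ x (S x)) {i j : Fin N} (hij : i < j) :
    C ≤ hS.eigenvalues hN i := by
  set u := hS.eigenvectorBasis hN with hu
  have hanti := hS.eigenvalues_antitone hN hij.le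
  obtain ⟨α, β, hαβ, hw⟩ : ∃ α β : ℝ, 0 < α ^ 2 + β ^ 2 ∧
      α * inner ℝ w (u i) + β * inner ℝ w (u j) = 0 := by
    by_cases h0 : inner ℝ w (u i) = 0
    · exact ⟨1, 0, by norm_num, by rw [h0]; ring⟩
    · refine ⟨inner ℝ w (u j), -inner ℝ w (u i), ?_, by ring⟩
      have : 0 < inner ℝ w (u i) ^ 2 := by positivity
      nlinarith [sq_nonneg (inner ℝ w (u j))]
  have hii : inner ℝ (u i) (u i) = (1 : ℝ) := by simp [u.orthonormal.1 i]
  have hjj : inner ℝ (u j) (u j) = (1 : ℝ) := by simp [u.orthonormal.1 j]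
  have hij0 : inner ℝ (u i) (u j) = (0 : ℝ) := u.orthonormal.2 hij.ne
  have hji0 : inner ℝ (u j) (u i) = (0 : ℝ) := u.orthonormal.2 hij.ne'
  have h1 := h (α • u i + β • u j) (by
    rw [inner_add_right, real_inner_smul_right, real_inner_smul_right, hw])
  have hSx : S (α • u i + β • u j) =
      (α * hS.eigenvalues hN i) • u i + (β * hS.eigenvalues hN j) • u j := by
    rw [map_add, map_smul, map_smul, hS.apply_eigenvectorBasis, hS.apply_eigenvectorBasis,
      smul_smul, smul_smul]
    rfl
  rw [hSx, ← real_inner_self_eq_norm_sq] at h1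
  simp only [inner_add_left, inner_add_right, real_inner_smul_left, real_inner_smul_right,
    hii, hjj, hij0, hji0] at h1
  have h2 : β ^ 2 * hS.eigenvalues hN j ≤ β ^ 2 * hS.eigenvalues hN i :=
    mul_le_mul_of_nonneg_left hanti (sq_nonneg β)
  have h3 : C * (α ^ 2 + β ^ 2) ≤ hS.eigenvalues hN i * (α ^ 2 + β ^ 2) := by nlinarith
  exact le_of_mul_le_mul_right h3 hαβ

end Eigenvalues

/-! ### Spectrum of the stacked Gram matrix -/

lemma inner_toEuclideanLin_gram {m : Type*} [Finite m] (A : Matrix m (Fin n) ℝ) (inst : Fintype m)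
    (x : EuclideanSpace ℝ (Fin n)) :
    inner ℝ x (Matrix.toEuclideanLin (gram A) x) = ∑ s, (A.mulVec x s) ^ 2 := by
  have h : gram A = A.transpose * A := by
    unfold gram
    convert rfl
  rw [h, EuclideanSpace.inner_eq_star_dotProduct]
  simp only [Matrix.toLpLin_apply, star_trivial]
  rw [← Matrix.mulVec_mulVec, dotProduct_comm, Matrix.dotProduct_mulVec, Matrix.vecMul_transpose]
  simp [dotProduct, pow_two]

lemma lambda_le {A : Matrix (Fin n) (Fin n) ℝ} (hA : A.IsHermitian) {C : ℝ}
    (h : ∀ x : EuclideanSpace ℝ (Fin n), inner ℝ x (Matrix.toEuclideanLin A x) ≤ C * ‖x‖ ^ 2)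
    (k : ℕ) (hk : 1 ≤ k ∧ k ≤ n) : lambda hA k hk ≤ C :=
  eigenvalues_le_of_inner_le _ _ h _

lemma le_lambda {A : Matrix (Fin n) (Fin n) ℝ} (hA : A.IsHermitian) {C : ℝ}
    (w : EuclideanSpace ℝ (Fin n))
    (h : ∀ x : EuclideanSpace ℝ (Fin n), inner ℝ w x = 0 →
      C * ‖x‖ ^ 2 ≤ inner ℝ x (Matrix.toEuclideanLin A x))
    (k : ℕ) (hk : 1 ≤ k ∧ k ≤ n) (hkn : k < n) : C ≤ lambda hA k hk :=
  -- In zero-based indexing `λ_k` sits at `k - 1`, so index `k` supplies the second eigenvector.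
  -- This is where `k < n` is needed.
  le_eigenvalues_of_le_inner _ _ w h (j := ⟨k, by rw [Fintype.card_fin]; exact hkn⟩)
    (Fin.mk_lt_mk.2 (by omega))

lemma lambda_antitone {A : Matrix (Fin n) (Fin n) ℝ} (hA : A.IsHermitian) {k l : ℕ}
    (hk : 1 ≤ k ∧ k ≤ n) (hl : 1 ≤ l ∧ l ≤ n) (hkl : k ≤ l) : lambda hA l hl ≤ lambda hA k hk :=
  hA.eigenvalues₀_antitone (Fin.mk_le_mk.2 (by omega))

lemma incidence_mulVec_sq {G : SimpleGraph (Fin n)} (o : EdgeOrientation G) (x : Fin n → ℝ)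
    (e : G.edgeSet) : (∑ v, incidence o e v * x v) ^ 2 = sqDiff x e := by
  have hne : o.tail e ≠ o.head e := by
    intro h
    have h1 := e.2
    rw [← o.spec e, h] at h1
    exact SimpleGraph.not_isDiag_of_mem_edgeSet _ h1 rfl
  have h : ∀ v, incidence o e v * x v =
      (if v = o.tail e then x v else 0) - (if v = o.head e then x v else 0) := by
    intro v
    by_cases h1 : v = o.tail e
    · have h2 : v ≠ o.head e := h1 ▸ hne
      simp [incidence, h1, hne]
    · by_cases h2 : v = o.head e
      · simp [incidence, h2, hne.symm]
      · simp [incidence, h1, h2]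
  rw [← o.spec e]
  simp [h]

lemma inner_gram_stackedMatrix {g : Fin T → SimpleGraph (Fin n)} (o : ∀ t, EdgeOrientation (g t))
    (b : TimedPair n T → Bool) (hg : g = graphsOf b) (x : EuclideanSpace ℝ (Fin n)) :
    inner ℝ x (Matrix.toEuclideanLin (gram (stackedMatrix o)) x) =
      ∑ k, if b k then sqDiff x k.2 else 0 := by
  let inst := Fintype.ofFinite (Σ t, (g t).edgeSet)
  rw [inner_toEuclideanLin_gram _ inst, ← sum_sigma_edgeSet g inst b hg fun _ e => sqDiff x e]
  refine Finset.sum_congr rfl fun s _ => ?_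
  rw [← incidence_mulVec_sq (o s.1)]
  rfl

lemma sum_mul_sqDiff (p : Fin T → unitInterval) (x : EuclideanSpace ℝ (Fin n)) :
    ∑ k : TimedPair n T, (p k.1 : ℝ) * sqDiff x k.2 =
      (∑ t, (p t : ℝ)) * (n * ‖x‖ ^ 2 - (∑ i, x i) ^ 2) := by
  rw [Fintype.sum_prod_type, EuclideanSpace.real_norm_sq_eq, ← sum_sqDiff, Finset.sum_mul]
  simp_rw [Finset.mul_sum]

/-- All nontrivial eigenvalues of the Laplacian concentrate around `n * p_sum`, with an explicit
probability of failure. -/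
theorem bernoulliPi_exists_lt_abs_laplacian_le (p : Fin T → unitInterval) :
    (bernoulliPi fun k : TimedPair n T => p k.1).real
        {b | ∃ x : EuclideanSpace ℝ (Fin n), n * (∑ t, (p t : ℝ)) / 2 * ‖x‖ ^ 2 <
          |∑ k, centered (fun k : TimedPair n T => p k.1) b k * sqDiff x k.2|} ≤
      2 * (n * Real.exp (-(n * (∑ t, (p t : ℝ)) / 32))) := by
  have hp : 0 ≤ ∑ t, (p t : ℝ) := Finset.sum_nonneg fun t _ => (p t).2.1
  have h := bernoulliPi_exists_lt_abs_sum_le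
    (fun k : TimedPair n T => pairVector (k.2 : Sym2 (Fin n)))
    (fun k => p k.1) 2 (n * ∑ t, (p t : ℝ)) (by norm_num) (by positivity)
    (fun k => norm_pairVector_sq_le _)
    (fun x => by
      simp_rw [inner_pairVector_sq]
      rw [sum_mul_sqDiff]
      nlinarith [mul_nonneg hp (sq_nonneg (∑ i, x i))])
    -- With `r = 2` and `μ = n * p_sum`, the choice `θ = 1 / 8` gives the exponent `n * p_sum * (1 /
    -- 32 - 1 / 16)`.
    (1 / 8) (n * (∑ t, (p t : ℝ)) / 2) (by norm_num) (by norm_num)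
  simp_rw [inner_pairVector_sq] at h
  rw [finrank_euclideanSpace_fin] at h
  convert h using 4
  ring

/-- Bounds for the eigenvalues of the Gram matrix outside of the exceptional event. -/
lemma lambda_gram_stackedMatrix_bounds (p : Fin T → unitInterval)
    {g : Fin T → SimpleGraph (Fin n)} (o : ∀ t, EdgeOrientation (g t))
    (b : TimedPair n T → Bool) (hg : g = graphsOf b) (hn : 2 ≤ n)
    (h1 : 1 ≤ 1 ∧ 1 ≤ n) (hn1 : 1 ≤ n - 1 ∧ n - 1 ≤ n)
    (hb : ∀ x : EuclideanSpace ℝ (Fin n),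
      |∑ k, centered (fun k : TimedPair n T => p k.1) b k * sqDiff x k.2| ≤
        n * (∑ t, (p t : ℝ)) / 2 * ‖x‖ ^ 2) :
    n * (∑ t, (p t : ℝ)) / 2 ≤
        lambda (gram_isHermitian (stackedMatrix o)) (n - 1) hn1 ∧
      lambda (gram_isHermitian (stackedMatrix o)) (n - 1) hn1 ≤
        lambda (gram_isHermitian (stackedMatrix o)) 1 h1 ∧
      lambda (gram_isHermitian (stackedMatrix o)) 1 h1 ≤
        3 * n * (∑ t, (p t : ℝ)) / 2 := by
  have hp : 0 ≤ ∑ t, (p t : ℝ) := Finset.sum_nonneg fun t _ => (p t).2.1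
  have hform : ∀ x : EuclideanSpace ℝ (Fin n),
      inner ℝ x (Matrix.toEuclideanLin (gram (stackedMatrix o)) x) =
        ∑ k, centered (fun k : TimedPair n T => p k.1) b k * sqDiff x k.2 +
          (∑ t, (p t : ℝ)) * (n * ‖x‖ ^ 2 - (∑ i, x i) ^ 2) := by
    intro x
    rw [inner_gram_stackedMatrix o b hg, ← sum_mul_sqDiff, ← Finset.sum_add_distrib]
    refine Finset.sum_congr rfl fun k _ => ?_
    rw [centered]
    split_ifs <;> ring
  -- The all-ones vector spans the kernel direction to be removed. Orthogonality to it kills the `J`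
  -- term of the mean.
  refine ⟨le_lambda _ (WithLp.toLp 2 fun _ => 1) (fun x hx => ?_) _ _ (by omega),
    lambda_antitone _ _ _ (by omega), lambda_le _ (fun x => ?_) _ _⟩
  · have hx0 : ∑ i, x i = 0 := by
      simpa [EuclideanSpace.inner_eq_star_dotProduct, dotProduct] using hx
    rw [hform, hx0]
    have := (abs_le.1 (hb x)).1
    nlinarith
  · rw [hform]
    have := (abs_le.1 (hb x)).2
    nlinarith [mul_nonneg hp (sq_nonneg (∑ i, x i))]

/-! ### Degrees and the norm of the block matrix -/

/-- **Hoeffding's inequality** for sums of independent centered Bernoulli variables. -/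
lemma bernoulliPi_lt_sum_centered_le {κ : Type*} [Fintype κ] (q : κ → unitInterval)
    (K : Finset κ) {N ε : ℝ} (hK : K.card ≤ N) (hε : 0 ≤ ε) :
    (bernoulliPi q).real {b | ε < ∑ k ∈ K, centered q b k} ≤ Real.exp (-(2 * ε ^ 2 / N)) := by
  have hind : iIndepFun (fun k (b : κ → Bool) => centered q b k) (bernoulliPi q) :=
    iIndepFun_pi (X := fun k (c : Bool) => (if c then (1 : ℝ) else 0) - (q k : ℝ))
      fun k => (measurable_of_finite _).aemeasurable
  have hsub : ∀ k ∈ K, HasSubgaussianMGF (fun b => centered q b k) (1 / 4) (bernoulliPi q) := by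
    intro k _
    have h1 : HasSubgaussianMGF (fun c : Bool => (if c then (1 : ℝ) else 0) - (q k : ℝ)) (1 / 4)
        (bernoulliMeasure true false (q k)) := by
      have h := hasSubgaussianMGF_of_mem_Icc (μ := bernoulliMeasure true false (q k)) (a := 0)
        (b := 1) (X := fun c : Bool => if c then (1 : ℝ) else 0)
        (measurable_of_finite _).aemeasurable
        (Filter.Eventually.of_forall fun c => by cases c <;> simp)
      rw [integral_bernoulliMeasure] at h
      convert! h using 1
      · funext c
        simp
      · ext
        norm_num
    rw [← (measurePreserving_eval (fun k => bernoulliMeasure true false (q k)) k).map_eq] at h1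
    exact HasSubgaussianMGF.of_map (μ := bernoulliPi q) (Y := Function.eval k)
      (measurable_pi_apply k).aemeasurable h1
  -- The empty sum is separated because the Hoeffding exponent is divided by `K.card`; there the
  -- strict inequality makes the event empty.
  rcases K.eq_empty_or_nonempty with rfl | hne
  · have : {b : κ → Bool | ε < ∑ k ∈ ∅, centered q b k} = ∅ := by
      ext b
      simpa using hε
    rw [this]
    simpa using (Real.exp_pos _).le
  · have h := HasSubgaussianMGF.measure_sum_ge_le_of_iIndepFun hind hsub hε
    have hsubset : {b | ε < ∑ k ∈ K, centered q b k} ⊆ {b | ε ≤ ∑ k ∈ K, centered q b k} :=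
      Set.ofPred_subset_ofPred.2 fun _ => le_of_lt
    refine (measureReal_mono hsubset).trans (h.trans (Real.exp_le_exp.2 ?_))
    have hpos : (0 : ℝ) < K.card := by exact_mod_cast hne.card_pos
    have he : -ε ^ 2 / (2 * ((∑ _k ∈ K, (1 / 4 : NNReal) : NNReal) : ℝ)) =
        -(2 * ε ^ 2 / K.card) := by
      simp only [Finset.sum_const, nsmul_eq_mul]
      push_cast
      field_simp
      ring
    rw [he]
    exact neg_le_neg (div_le_div_of_nonneg_left (by positivity) hpos hK)

/-- The pairs of the `t`-th graph which contain `v`. -/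
def incidentPairs (t : Fin T) (v : Fin n) : Finset (TimedPair n T) :=
  Finset.univ.filter fun k => k.1 = t ∧ v ∈ (k.2 : Sym2 (Fin n))

lemma card_incidentPairs_le (t : Fin T) (v : Fin n) : (incidentPairs t v).card ≤ n := by
  have h : (incidentPairs t v).card ≤ (Finset.univ.image fun w : Fin n => s(v, w)).card := by
    refine Finset.card_le_card_of_injOn (fun k => (k.2 : Sym2 (Fin n))) ?_ ?_
    · intro k hk
      obtain ⟨w, hw⟩ := (Finset.mem_filter.1 hk).2.2
      simp only [Finset.coe_image, Finset.coe_univ, Set.image_univ, Set.mem_range]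
      exact ⟨w, hw.symm⟩
    · rintro ⟨t1, e1⟩ h1 ⟨t2, e2⟩ h2 h
      have h1' := (Finset.mem_filter.1 h1).2.1
      have h2' := (Finset.mem_filter.1 h2).2.1
      exact Prod.ext (h1'.trans h2'.symm) (Subtype.ext h)
  exact h.trans (Finset.card_image_le.trans (by simp))

lemma sqDiff_le (y : Fin n → ℝ) (e : Sym2 (Fin n)) (he : ¬ e.IsDiag) :
    sqDiff y e ≤ 2 * ∑ v, if v ∈ e then y v ^ 2 else 0 := by
  induction e with
  | _ i j =>
    have hij : i ≠ j := he
    have h : ∑ v, (if v ∈ s(i, j) then y v ^ 2 else 0) = y i ^ 2 + y j ^ 2 := by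
      rw [← Finset.sum_filter, ← Finset.sum_pair (f := fun v => y v ^ 2) hij]
      refine Finset.sum_congr ?_ fun _ _ => rfl
      ext v
      simp
    rw [h, sqDiff_mk]
    nlinarith [sq_nonneg (y i + y j)]

/-- Each edge charges `2 (y i ^ 2 + y j ^ 2)` to its endpoints. Exchanging the sums makes every
vertex pay its degree, at most `D`. -/
lemma sum_sqDiff_le (b : TimedPair n T → Bool) (y : Fin T → Fin n → ℝ) {D : ℝ}
    (hD : ∀ t v, ∑ k ∈ incidentPairs t v, (if b k then (1 : ℝ) else 0) ≤ D) :
    ∑ k, (if b k then sqDiff (y k.1) k.2 else 0) ≤ 2 * D * ∑ t, ∑ v, y t v ^ 2 := by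
  calc ∑ k, (if b k then sqDiff (y k.1) k.2 else 0)
      ≤ ∑ k : TimedPair n T, ∑ t, ∑ v, 2 * (y t v ^ 2 *
          (if k.1 = t ∧ v ∈ (k.2 : Sym2 (Fin n)) then (if b k then (1 : ℝ) else 0) else 0)) := by
        refine Finset.sum_le_sum fun k _ => ?_
        rw [Finset.sum_eq_single k.1 (fun t _ ht => by simp [ht.symm]) (by simp)]
        cases b k
        · simp
        · refine (sqDiff_le (y k.1) k.2 k.2.2).trans (le_of_eq ?_)
          rw [Finset.mul_sum]
          exact Finset.sum_congr rfl fun v _ => by simp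
    _ = ∑ t, ∑ v, 2 * (y t v ^ 2 * ∑ k ∈ incidentPairs t v, (if b k then (1 : ℝ) else 0)) := by
        rw [Finset.sum_comm]
        refine Finset.sum_congr rfl fun t _ => ?_
        rw [Finset.sum_comm]
        refine Finset.sum_congr rfl fun v _ => ?_
        rw [← Finset.mul_sum, ← Finset.mul_sum, incidentPairs, Finset.sum_filter]
    _ ≤ _ := by
        rw [Finset.mul_sum]
        refine Finset.sum_le_sum fun t _ => ?_
        rw [Finset.mul_sum]
        refine Finset.sum_le_sum fun v _ => ?_
        nlinarith [mul_le_mul_of_nonneg_left (hD t v) (sq_nonneg (y t v))]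

lemma specNorm_le {m k : Type*} [Finite m] [Finite k] (instm : Fintype m) (instk : Fintype k)
    (A : Matrix m k ℝ) {C : ℝ} (hC : 0 ≤ C)
    (h : ∀ x : k → ℝ, ∑ s, (A.mulVec x s) ^ 2 ≤ C ^ 2 * ∑ i, x i ^ 2) : specNorm A ≤ C := by
  classical
  unfold specNorm
  rw [Subsingleton.elim (Fintype.ofFinite m) instm, Subsingleton.elim (Fintype.ofFinite k) instk]
  rw [Matrix.l2_opNorm_def]
  refine ContinuousLinearMap.opNorm_le_bound _ hC fun x => ?_
  refine le_of_sq_le_sq ?_ (by positivity)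
  rw [mul_pow, EuclideanSpace.real_norm_sq_eq, EuclideanSpace.real_norm_sq_eq]
  exact h x

lemma blockMatrix_mulVec_sq {g : Fin T → SimpleGraph (Fin n)} (o : ∀ t, EdgeOrientation (g t))
    (x : (Σ _ : Fin T, Fin n) → ℝ) (s : Σ t, (g t).edgeSet) :
    ((blockMatrix o).mulVec x s) ^ 2 = sqDiff (fun v => x ⟨s.1, v⟩) s.2 := by
  obtain ⟨t, e⟩ := s
  rw [← incidence_mulVec_sq (o t)]
  congr 1
  rw [Matrix.mulVec, dotProduct, Fintype.sum_sigma, Finset.sum_eq_single t]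
  · simp only [blockMatrix, Matrix.blockDiagonal'_apply_eq]
  · intro t' _ ht
    refine Finset.sum_eq_zero fun v _ => ?_
    rw [blockMatrix, Matrix.blockDiagonal'_apply_ne _ _ _ ht.symm, zero_mul]
  · simp

lemma specNorm_blockMatrix_le {g : Fin T → SimpleGraph (Fin n)} (o : ∀ t, EdgeOrientation (g t))
    (b : TimedPair n T → Bool) (hg : g = graphsOf b) {D : ℝ} (hD0 : 0 ≤ D)
    (hD : ∀ t v, ∑ k ∈ incidentPairs t v, (if b k then (1 : ℝ) else 0) ≤ D) :
    specNorm (blockMatrix o) ≤ √(2 * D) := by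
  let inst := Fintype.ofFinite (Σ t, (g t).edgeSet)
  refine specNorm_le inst inferInstance _ (Real.sqrt_nonneg _) fun x => ?_
  rw [Real.sq_sqrt (by positivity), Fintype.sum_sigma]
  simp_rw [blockMatrix_mulVec_sq]
  rw [sum_sigma_edgeSet g inst b hg fun t e => sqDiff (fun v => x ⟨t, v⟩) e]
  exact sum_sqDiff_le b (fun t v => x ⟨t, v⟩) hD

/-- Subadditivity of the square root. With `ε = √(n L / 2)` one has `2 ε = √(2 n L)`, whose square
root is the fourth root in the theorem. -/
lemma sqrt_add_le_sqrt_add_rpow {P ε M : ℝ} (hP : 0 ≤ P) (hM : 0 ≤ M) (hε : 2 * ε = √M) :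
    √(2 * (P + ε)) ≤ √(2 * P) + M ^ (1 / 4 : ℝ) := by
  have h1 : M ^ (1 / 4 : ℝ) = √(√M) := by
    rw [Real.sqrt_eq_rpow, Real.sqrt_eq_rpow, ← Real.rpow_mul hM]
    norm_num
  rw [h1, mul_add, hε]
  refine Real.sqrt_le_iff.2 ⟨by positivity, ?_⟩
  rw [add_sq, Real.sq_sqrt (by positivity), Real.sq_sqrt (by positivity)]
  have : 0 ≤ 2 * √(2 * P) * √(√M) := by positivity
  linarith

/-- With high probability, all degrees exceed their means by at most `√(n log (n T / δ) / 2)`. -/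
lemma bernoulliPi_exists_degree_le (hn : 1 ≤ n) (hT : 1 ≤ T) (p : Fin T → unitInterval) {δ : ℝ}
    (hδ : 0 < δ) (hδ1 : δ < 1) :
    (bernoulliPi fun k : TimedPair n T => p k.1).real
        {b | ∃ t v, √(n * Real.log (n * T / δ) / 2) <
          ∑ k ∈ incidentPairs t v, centered (fun k : TimedPair n T => p k.1) b k} ≤ δ := by
  have hn' : (1 : ℝ) ≤ n := by exact_mod_cast hn
  have hT' : (1 : ℝ) ≤ T := by exact_mod_cast hT
  have hnT : (1 : ℝ) ≤ n * T := by nlinarith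
  have hquot : 1 ≤ n * T / δ := by
    rw [le_div_iff₀ hδ]; linarith
  have hL : 0 ≤ Real.log (n * T / δ) := Real.log_nonneg hquot
  set ε := √(n * Real.log (n * T / δ) / 2) with hε
  have hε2 : ε ^ 2 = n * Real.log (n * T / δ) / 2 := Real.sq_sqrt (by positivity)
  have hset : {b | ∃ t v, ε <
      ∑ k ∈ incidentPairs t v, centered (fun k : TimedPair n T => p k.1) b k} =
      ⋃ i ∈ (Finset.univ : Finset (Fin T × Fin n)), {b | ε <
      ∑ k ∈ incidentPairs i.1 i.2, centered (fun k : TimedPair n T => p k.1) b k} := by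
    ext b
    simp
  rw [hset]
  refine (measureReal_biUnion_finset_le _ _).trans ?_
  calc _ ≤ ∑ i : Fin T × Fin n, Real.exp (-(2 * ε ^ 2 / n)) :=
        Finset.sum_le_sum fun i _ => bernoulliPi_lt_sum_centered_le _ _
          (by exact_mod_cast card_incidentPairs_le i.1 i.2) (Real.sqrt_nonneg _)
    _ = δ := by
        have h1 : 2 * ε ^ 2 / n = Real.log (n * T / δ) := by
          rw [hε2]; field_simp
        rw [h1, Real.exp_neg, Real.exp_log (by linarith)]
        simp only [Finset.sum_const, Finset.card_univ, Fintype.card_prod, Fintype.card_fin,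
          nsmul_eq_mul, Nat.cast_mul]
        field_simp

lemma specNorm_blockMatrix_le_min (p : Fin T → unitInterval) {g : Fin T → SimpleGraph (Fin n)}
    (o : ∀ t, EdgeOrientation (g t)) (b : TimedPair n T → Bool) (hg : g = graphsOf b) {L : ℝ}
    (hL : 0 ≤ L) (hb : ∀ t v,
      ∑ k ∈ incidentPairs t v, centered (fun k : TimedPair n T => p k.1) b k ≤ √(n * L / 2)) :
    specNorm (blockMatrix o) ≤
      min (√(2 * n * ⨆ t, (p t : ℝ)) + (2 * n * L) ^ (1 / 4 : ℝ)) √(2 * n) := by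
  have hP : 0 ≤ ⨆ t, (p t : ℝ) := Real.iSup_nonneg fun t => (p t).2.1
  have hcard : ∀ (t : Fin T) (v : Fin n), ((incidentPairs t v).card : ℝ) ≤ n := fun t v => by
    exact_mod_cast card_incidentPairs_le t v
  refine le_min ?_ ?_
  · refine (specNorm_blockMatrix_le o b hg (D := n * (⨆ t, (p t : ℝ)) + √(n * L / 2))
      (by positivity) fun t v => ?_).trans ?_
    · have h1 := hb t v
      simp only [centered, Finset.sum_sub_distrib] at h1
      have h2 : ∑ k ∈ incidentPairs t v, (p k.1 : ℝ) ≤ n * ⨆ t, (p t : ℝ) := by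
        refine (Finset.sum_le_card_nsmul _ _ (⨆ t, (p t : ℝ)) fun k _ =>
          le_ciSup (f := fun t => (p t : ℝ)) (Set.finite_range _).bddAbove k.1).trans ?_
        rw [nsmul_eq_mul]
        exact mul_le_mul_of_nonneg_right (hcard t v) hP
      linarith
    · have h := sqrt_add_le_sqrt_add_rpow (P := n * ⨆ t, (p t : ℝ)) (ε := √(n * L / 2))
        (M := 2 * n * L) (by positivity) (by positivity) (by
          rw [show 2 * n * L = 2 ^ 2 * (n * L / 2) by ring, Real.sqrt_mul (by norm_num),
            Real.sqrt_sq (by norm_num)])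
      rwa [← mul_assoc 2 (n : ℝ) (⨆ t, (p t : ℝ))] at h
  · refine specNorm_blockMatrix_le o b hg (by positivity) fun t v => ?_
    refine (Finset.sum_le_card_nsmul _ _ (1 : ℝ) fun k _ => by split_ifs <;> norm_num).trans ?_
    simpa using hcard t v

/-- The constant `64 = 2 * 32` makes the exponential at most `(δ / n) ^ 2`. One factor `δ / n` pays
for the dimension `n`, and the other, with `n ≥ 2`, for the factor `2` of the two tails. -/
lemma two_mul_exp_le {P δ : ℝ} (hn : 2 ≤ n) (hδ : 0 < δ) (hδ1 : δ < 1)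
    (h : 64 * (Real.log (n / δ) / n) ≤ P) : 2 * (n * Real.exp (-(n * P / 32))) ≤ δ := by
  have hn' : (2 : ℝ) ≤ n := by exact_mod_cast hn
  have hn0 : (0 : ℝ) < n := by linarith
  have hq : 0 < n / δ := by positivity
  have h1 : 2 * Real.log (n / δ) ≤ n * P / 32 := by
    have h2 := mul_le_mul_of_nonneg_left h hn0.le
    have h3 : n * (64 * (Real.log (n / δ) / n)) = 64 * Real.log (n / δ) := by field_simp
    linarith
  have h2 : Real.exp (-(n * P / 32)) ≤ (δ / n) ^ 2 := by
    refine (Real.exp_le_exp.2 (neg_le_neg h1)).trans (le_of_eq ?_)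
    rw [two_mul, neg_add, Real.exp_add, Real.exp_neg, Real.exp_log hq, inv_div, pow_two]
  calc 2 * (n * Real.exp (-(n * P / 32))) ≤ 2 * (n * (δ / n) ^ 2) := by gcongr
    _ = δ * (2 * δ / n) := by field_simp
    _ ≤ δ * 1 := by
        refine mul_le_mul_of_nonneg_left ?_ hδ.le
        rw [div_le_one hn0]
        linarith
    _ = δ := mul_one δ

end TransSync

theorem mainTheorem8 :
    ∃ c : ℝ, 0 < c ∧
      ∀ (n T : ℕ), 1 ≤ n → 1 ≤ T →
      ∀ (p : Fin T → unitInterval)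
        (Ω : Type*) [MeasurableSpace Ω] (μ : Measure Ω) [IsProbabilityMeasure μ]
        (G : Fin T → Ω → SimpleGraph (Fin n)),
        (∀ t, HasLaw (G t) (SimpleGraph.binomialRandom (Fin n) (p t)) μ) →
        iIndepFun G μ →
      ∀ (o : ∀ (ω : Ω) (t : Fin T), TransSync.EdgeOrientation (G t ω))
        (δ : ℝ), 0 < δ → δ < 1 →
        (∀ hn : 2 ≤ n,
          c * (Real.log (n / δ) / n) ≤ ∑ t, (p t : ℝ) →
          1 - δ ≤ μ.real {ω |
            n * (∑ t, (p t : ℝ)) / 2 ≤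
              TransSync.lambda (TransSync.gram_isHermitian (TransSync.stackedMatrix (o ω)))
                (n - 1) ⟨by omega, by omega⟩ ∧
            TransSync.lambda (TransSync.gram_isHermitian (TransSync.stackedMatrix (o ω)))
                (n - 1) ⟨by omega, by omega⟩ ≤
              TransSync.lambda (TransSync.gram_isHermitian (TransSync.stackedMatrix (o ω)))
                1 ⟨by omega, by omega⟩ ∧
            TransSync.lambda (TransSync.gram_isHermitian (TransSync.stackedMatrix (o ω)))
                1 ⟨by omega, by omega⟩ ≤
              3 * n * (∑ t, (p t : ℝ)) / 2}) ∧
        1 - δ ≤ μ.real {ω |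
          TransSync.specNorm (TransSync.blockMatrix (o ω)) ≤
            min (√(2 * n * ⨆ t, (p t : ℝ)) + (2 * n * Real.log (n * T / δ)) ^ (1 / 4 : ℝ))
              √(2 * n)} := by
  refine ⟨64, by norm_num, ?_⟩
  intro n T hn hT p Ω _ μ _ G hG hi o δ hδ hδ1
  refine ⟨fun hn2 hc => ?_, ?_⟩
  · refine TransSync.one_sub_le_measureReal_of_graphsOf hG hi _ _
      ((TransSync.bernoulliPi_exists_lt_abs_laplacian_le p).trans
        (TransSync.two_mul_exp_le hn2 hδ hδ1 hc)) fun ω b hω hb => ?_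
    simp only [Set.mem_ofPred_eq, not_exists, not_lt] at hb
    exact TransSync.lambda_gram_stackedMatrix_bounds p (o ω) b hω hn2 _ _ hb
  · refine TransSync.one_sub_le_measureReal_of_graphsOf hG hi _ _
      (TransSync.bernoulliPi_exists_degree_le hn hT p hδ hδ1) fun ω b hω hb => ?_
    simp only [Set.mem_ofPred_eq, not_exists, not_lt] at hb
    have hn' : (1 : ℝ) ≤ n := by exact_mod_cast hn
    have hT' : (1 : ℝ) ≤ T := by exact_mod_cast hT
    refine TransSync.specNorm_blockMatrix_le_min p (o ω) b hω (Real.log_nonneg ?_) hb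
    rw [le_div_iff₀ hδ]
    nlinarith
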